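/- A lattice polytope in $\mathbb{R}^m$ is the convex hull of finitely many points of $\mathbb{Z}^m$; its size is the number of points of $\mathbb{Z}^m$ that it contains. Consider the pyramid $$\mathcal{M}_9=\operatorname{conv}\{(-1,0,0),(2,0,0),(0,-1,0),(0,2,0),(1,1,3)\}\subset\mathbb{R}^3$$ and the triangular prism $$\mathcal{M}_{10}=\operatorname{conv}\{(1,0,0),(0,1,0),(-1,-1,0),(2,2,3),(1,3,3),(0,1,3)\}\subset\mathbb{R}^3 .$$ For $Q\in\{\mathcal{M}_9,\mathcal{M}_{10}\}$, a lift of $Q$ is a lattice polytope $P\subset\mathbb{R}^4$ (of dimension $4$, or degenerate of dimension $3$) together with a lattice projection $\pi:\mathbb{R}^4\to\mathbb{R}^3$, that is, an affine map with $\pi(\mathbb{Z}^4)=\mathbb{Z}^3$, such that $\pi(P)=Q$. Two lifts $(P_1,\pi_1)$ and $(P_2,\pi_2)$ of $Q$ are equivalent if there is an affine automorphism $f$ of $\mathbb{R}^4$ with $f(\mathbb{Z}^4)=\mathbb{Z}^4$, $f(P_1)=P_2$ and $\pi_2\circ f=\pi_1$ on $P_1$. Then, for every $n\in\mathbb{N}$,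 the pyramid $\mathcal{M}_9$ has only finitely many equivalence classes of lifts of size $n$, and the prism $\mathcal{M}_{10}$ has only finitely many equivalence classes of lifts of size $n$. In particular, each of the two has only finitely many $4$-dimensional lifts of any fixed size, up to equivalence. -/

import Mathlib

/-- The integer lattice `ℤ^d` inside `ℝ^d`. -/
def intLattice (d : ℕ) : Set (Fin d → ℝ) :=
  Set.range (fun (z : Fin d → ℤ) (i : Fin d) => (z i : ℝ))

/-- A lattice polytope in `ℝ^d` (of any dimension): the convex hull of finitely many points
of `ℤ^d`. -/
def IsLatticePolytope {d : ℕ} (P : Set (Fin d → ℝ)) : Prop :=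
  ∃ S : Set (Fin d → ℝ), S.Finite ∧ S ⊆ intLattice d ∧ P = convexHull ℝ S

/-- The size of `P`: the number of lattice points in `P`. -/
noncomputable def latticeSize {d : ℕ} (P : Set (Fin d → ℝ)) : ℕ∞ :=
  (P ∩ intLattice d).encard

/-- A lattice projection: an affine map `ℝ^m → ℝ^d` that maps `ℤ^m` onto `ℤ^d`. -/
def IsLatticeProjection {m d : ℕ} (π : (Fin m → ℝ) →ᵃ[ℝ] (Fin d → ℝ)) : Prop :=
  π '' intLattice m = intLattice d

/-- A unimodular (affine) transformation of `ℝ^d`: an affine automorphism that maps `ℤ^d`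
onto itself. -/
def IsUnimodular {d : ℕ} (f : (Fin d → ℝ) ≃ᵃ[ℝ] (Fin d → ℝ)) : Prop :=
  f '' intLattice d = intLattice d

/-- A lift of `Q ⊆ ℝ^d`: a lattice polytope `P ⊆ ℝ^(d+1)` together with a lattice projection
`π` such that `π(P) = Q`. Full-dimensional and degenerate polytopes `P` are both admitted. -/
structure LatticeLift {d : ℕ} (Q : Set (Fin d → ℝ)) where
  /-- the upstairs polytope -/
  P : Set (Fin (d + 1) → ℝ)
  /-- the projection -/
  π : (Fin (d + 1) → ℝ) →ᵃ[ℝ] (Fin d → ℝ)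
  isLatticePolytope : IsLatticePolytope P
  isLatticeProjection : IsLatticeProjection π
  image_eq : π '' P = Q

/-- Two lifts `π₁ : P₁ → Q` and `π₂ : P₂ → Q` are equivalent if there is a unimodular
equivalence `f : P₁ → P₂` with `π₂ ∘ f = π₁`. -/
def LatticeLift.Equivalent {d : ℕ} {Q : Set (Fin d → ℝ)} (L₁ L₂ : LatticeLift Q) : Prop :=
  ∃ f : (Fin (d + 1) → ℝ) ≃ᵃ[ℝ] (Fin (d + 1) → ℝ),
    IsUnimodular f ∧ f '' L₁.P = L₂.P ∧ ∀ x ∈ L₁.P, L₂.π (f x) = L₁.π x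

theorem LatticeLift.equivalent_equivalence {d : ℕ} (Q : Set (Fin d → ℝ)) :
    Equivalence (LatticeLift.Equivalent (Q := Q)) where
  refl L := ⟨AffineEquiv.refl ℝ _, by simp [IsUnimodular], by simp, by simp⟩
  symm := by
    rintro L₁ L₂ ⟨f, hf, hP, hπ⟩
    refine ⟨f.symm, ?_, ?_, ?_⟩
    · unfold IsUnimodular at hf ⊢
      conv_lhs => rw [← hf]
      rw [← Set.image_comp]
      simp
    · rw [← hP, ← Set.image_comp]
      simp
    · intro y hy
      rw [← hP] at hy
      obtain ⟨x, hx, rfl⟩ := hy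
      simp [hπ x hx]
  trans := by
    rintro L₁ L₂ L₃ ⟨f, hf, hP, hπ⟩ ⟨g, hg, hP', hπ'⟩
    refine ⟨f.trans g, ?_, ?_, ?_⟩
    · unfold IsUnimodular at hf hg ⊢
      rw [AffineEquiv.coe_trans, Set.image_comp, hf, hg]
    · rw [AffineEquiv.coe_trans, Set.image_comp, hP, hP']
    · intro x hx
      have hfx : f x ∈ L₂.P := hP ▸ Set.mem_image_of_mem f hx
      simp [hπ' _ hfx, hπ x hx]

/-- Equivalence of lifts, as a setoid. -/
def latticeLiftSetoid {d : ℕ} (Q : Set (Fin d → ℝ)) : Setoid (LatticeLift Q) :=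
  ⟨LatticeLift.Equivalent, LatticeLift.equivalent_equivalence Q⟩

/-- `Q` has finitely many lifts of bounded size: for every `n` there are only finitely many
equivalence classes of lifts of `Q` of size `n`. -/
def HasFinitelyManyLiftsOfBoundedSize {d : ℕ} (Q : Set (Fin d → ℝ)) : Prop :=
  ∀ n : ℕ, {c : Quotient (latticeLiftSetoid Q) |
    ∃ L : LatticeLift Q, latticeSize L.P = (n : ℕ∞) ∧ Quotient.mk _ L = c}.Finite

/-- The pyramid `𝓜₉` (the last point is the apex). -/
def polytopeM9 : Set (Fin 3 → ℝ) :=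
  convexHull ℝ {![-1, 0, 0], ![2, 0, 0], ![0, -1, 0], ![0, 2, 0], ![1, 1, 3]}

/-- The triangular prism `𝓜₁₀`. -/
def polytopeM10 : Set (Fin 3 → ℝ) :=
  convexHull ℝ {![1, 0, 0], ![0, 1, 0], ![-1, -1, 0], ![2, 2, 3], ![1, 3, 3], ![0, 1, 3]}

/-! A unimodular change of coordinates turns the projection of a lift into `forgetLast`, and each
vertex of `Q` then gets an integer height, that of a lattice point of `P` above it. Vertical chords
of `P` over lattice points have length at most `n + 1` when `P` has size `n`
(`sub_le_of_latticeSize_le`). Hence two convex combinations of vertices that represent the same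
lattice point have nearly equal heights. In both polytopes such coincidences generate all affine
dependencies of the vertices: one for the pyramid, two for the prism. The heights are therefore
affine up to a bounded error, also after rounding to integer coefficients, and a shear removes the
affine part. What remains lies in a fixed box, where there are finitely many lattice polytopes
(`hasFinitelyManyLifts_of_heights`). -/

/-! ### Normal form of a lattice projection, and transport of lifts. -/

/-- The lattice projection `ℝ^(d+1) → ℝ^d` that forgets the last coordinate. -/
noncomputable def forgetLast (d : ℕ) : (Fin (d + 1) → ℝ) →ᵃ[ℝ] (Fin d → ℝ) :=
  (LinearMap.funLeft ℝ ℝ (Fin.castSucc : Fin d → Fin (d + 1))).toAffineMap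

@[simp] theorem forgetLast_apply {d : ℕ} (x : Fin (d + 1) → ℝ) (i : Fin d) :
    forgetLast d x i = x i.castSucc := rfl

theorem mem_intLattice_iff {d : ℕ} {x : Fin d → ℝ} :
    x ∈ intLattice d ↔ ∀ i, ∃ z : ℤ, (z : ℝ) = x i := by
  constructor
  · rintro ⟨z, rfl⟩ i
    exact ⟨z i, rfl⟩
  · intro h
    choose z hz using h
    exact ⟨z, funext hz⟩

theorem intCast_mem_intLattice {d : ℕ} (z : Fin d → ℤ) :
    (fun i => (z i : ℝ)) ∈ intLattice d := ⟨z, rfl⟩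

/-- The affine map `x ↦ (g x, φ x)`. -/
noncomputable def snocMap {m d : ℕ} (g : (Fin m → ℝ) →ᵃ[ℝ] (Fin d → ℝ))
    (φ : (Fin m → ℝ) →ᵃ[ℝ] ℝ) : (Fin m → ℝ) →ᵃ[ℝ] (Fin (d + 1) → ℝ) :=
  AffineMap.pi (Fin.snoc (α := fun _ => (Fin m → ℝ) →ᵃ[ℝ] ℝ)
    (fun i => (LinearMap.proj i : (Fin d → ℝ) →ₗ[ℝ] ℝ).toAffineMap.comp g) φ)

@[simp] theorem snocMap_castSucc {m d : ℕ} (g : (Fin m → ℝ) →ᵃ[ℝ] (Fin d → ℝ))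
    (φ : (Fin m → ℝ) →ᵃ[ℝ] ℝ) (x : Fin m → ℝ) (i : Fin d) :
    snocMap g φ x i.castSucc = g x i := by
  simp [snocMap]

@[simp] theorem snocMap_last {m d : ℕ} (g : (Fin m → ℝ) →ᵃ[ℝ] (Fin d → ℝ))
    (φ : (Fin m → ℝ) →ᵃ[ℝ] ℝ) (x : Fin m → ℝ) :
    snocMap g φ x (Fin.last d) = φ x := by
  simp [snocMap]

theorem forgetLast_comp_snocMap {m d : ℕ} (g : (Fin m → ℝ) →ᵃ[ℝ] (Fin d → ℝ))
    (φ : (Fin m → ℝ) →ᵃ[ℝ] ℝ) (x : Fin m → ℝ) : forgetLast d (snocMap g φ x) = g x := by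
  ext i; simp

theorem isLatticeProjection_forgetLast (d : ℕ) : IsLatticeProjection (forgetLast d) := by
  apply Set.Subset.antisymm
  · rintro _ ⟨_, ⟨z, rfl⟩, rfl⟩
    exact ⟨fun i => z i.castSucc, rfl⟩
  · rintro _ ⟨z, rfl⟩
    exact ⟨_, intCast_mem_intLattice (Fin.snoc (α := fun _ => ℤ) z 0), by ext; simp⟩

/-- A surjection `ℤ^(d+1) → ℤ^d` is completed by one linear form to an isomorphism. -/
theorem exists_complementary_form {d : ℕ} (A : (Fin (d + 1) → ℤ) →ₗ[ℤ] (Fin d → ℤ))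
    (hA : Function.Surjective A) :
    ∃ φ : (Fin (d + 1) → ℤ) →ₗ[ℤ] ℤ, ∀ y t, ∃ x, A x = y ∧ φ x = t := by
  -- The section `s` splits `A`; the form sought is the projection `x ↦ x - s (A x)` onto the
  -- kernel, which is free of rank one.
  obtain ⟨s, hs⟩ := Module.projective_lifting_property A LinearMap.id hA
  have hs' : ∀ y, A (s y) = y := fun y => LinearMap.congr_fun hs y
  have hrank : Module.finrank ℤ (LinearMap.ker A) = 1 := by
    have h := Submodule.finrank_quotient_add_finrank (LinearMap.ker A)
    rw [(A.quotKerEquivOfSurjective hA).finrank_eq, Module.finrank_fin_fun,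
      Module.finrank_fin_fun] at h
    omega
  let e : LinearMap.ker A ≃ₗ[ℤ] ℤ := LinearEquiv.ofFinrankEq _ _ (by simpa using hrank)
  let p : (Fin (d + 1) → ℤ) →ₗ[ℤ] LinearMap.ker A :=
    (LinearMap.id - s ∘ₗ A).codRestrict _ (fun x => by simp [hs'])
  refine ⟨e.toLinearMap ∘ₗ p, fun y t => ⟨s y + e.symm t, ?_, ?_⟩⟩
  · simp [hs']
  · have : p (s y + e.symm t) = e.symm t := by
      apply Subtype.ext
      simp [p, hs']
    simp [this]

/-- A lattice projection `ℝ^(d+1) → ℝ^d` is completed by one affine form to a map of the lattice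
onto itself. -/
theorem IsLatticeProjection.exists_snocMap {d : ℕ} {π : (Fin (d + 1) → ℝ) →ᵃ[ℝ] (Fin d → ℝ)}
    (hπ : IsLatticeProjection π) :
    ∃ φ : (Fin (d + 1) → ℝ) →ᵃ[ℝ] ℝ,
      snocMap π φ '' intLattice (d + 1) = intLattice (d + 1) := by
  have hmem : ∀ z : Fin (d + 1) → ℤ, ∃ w : Fin d → ℤ,
      (fun i => (w i : ℝ)) = π (fun i => (z i : ℝ)) := fun z => by
    have : π (fun i => (z i : ℝ)) ∈ intLattice d := by
      rw [← hπ]; exact ⟨_, intCast_mem_intLattice z, rfl⟩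
    exact this
  choose a ha using hmem
  have hadd : ∀ z, ∀ i, (a z i : ℝ) = π.linear (fun j => (z j : ℝ)) i + a 0 i := by
    intro z i
    have h1 := congr_fun (ha z) i
    have h2 := congr_fun (ha 0) i
    have h3 := π.map_vadd 0 (fun j => (z j : ℝ))
    simp only [vadd_eq_add, add_zero] at h3
    rw [h1, h2, h3]
    simp only [Pi.add_apply, Pi.zero_apply, Int.cast_zero]
    rfl
  -- The linear part of `π` on integer points; `a 0` is its translation part.
  let A : (Fin (d + 1) → ℤ) →ₗ[ℤ] (Fin d → ℤ) :=
    { toFun := fun z i => a z i - a 0 i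
      map_add' := fun x y => by
        ext i
        have : (fun j => ((x + y) j : ℝ)) = (fun j => (x j : ℝ)) + fun j => (y j : ℝ) := by
          ext; simp
        have h := hadd (x + y) i
        rw [this, map_add, Pi.add_apply] at h
        have hx := hadd x i
        have hy := hadd y i
        have : ((a (x + y) i - a 0 i : ℤ) : ℝ) = ((a x i - a 0 i + (a y i - a 0 i) : ℤ) : ℝ) := by
          push_cast; linarith
        exact_mod_cast this
      map_smul' := fun c x => by
        ext i
        have : (fun j => ((c • x) j : ℝ)) = (c : ℝ) • fun j => (x j : ℝ) := by
          ext; simp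
        have h := hadd (c • x) i
        rw [this, map_smul, Pi.smul_apply, smul_eq_mul] at h
        have hx := hadd x i
        have : ((a (c • x) i - a 0 i : ℤ) : ℝ) = ((c * (a x i - a 0 i) : ℤ) : ℝ) := by
          push_cast; rw [h, hx]; ring
        simpa using (by exact_mod_cast this :
          a (c • x) i - a 0 i = c * (a x i - a 0 i)) }
  have hA : Function.Surjective A := by
    intro y
    have : (fun i => ((y + a 0) i : ℝ)) ∈ π '' intLattice (d + 1) := by
      rw [hπ]; exact intCast_mem_intLattice _
    obtain ⟨_, ⟨z, rfl⟩, hz⟩ := this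
    refine ⟨z, ?_⟩
    ext i
    have h := congr_fun hz i
    rw [← ha z] at h
    have h : (a z i : ℝ) = ((y i + a 0 i : ℤ) : ℝ) := h
    have h : a z i = y i + a 0 i := by exact_mod_cast h
    simp [A, h]
  obtain ⟨ψ, hψ⟩ := exists_complementary_form A hA
  let φ : (Fin (d + 1) → ℝ) →ₗ[ℝ] ℝ :=
    ∑ j, (ψ (Pi.single j 1) : ℝ) • (LinearMap.proj j : (Fin (d + 1) → ℝ) →ₗ[ℝ] ℝ)
  have hφ : ∀ z : Fin (d + 1) → ℤ, φ (fun j => (z j : ℝ)) = ψ z := by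
    intro z
    conv_rhs => rw [LinearMap.pi_apply_eq_sum_univ ψ z]
    simp only [φ, LinearMap.sum_apply, LinearMap.smul_apply, LinearMap.proj_apply, smul_eq_mul,
      Int.cast_sum, Int.cast_mul]
    refine Finset.sum_congr rfl fun j _ => ?_
    rw [mul_comm]
    congr 3
    ext i
    simp [Pi.single_apply, eq_comm]
  refine ⟨φ.toAffineMap, Set.Subset.antisymm ?_ ?_⟩
  · rintro _ ⟨_, ⟨z, rfl⟩, rfl⟩
    rw [mem_intLattice_iff]
    intro i
    refine Fin.lastCases ⟨ψ z, ?_⟩ (fun i => ⟨a z i, ?_⟩) i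
    · simp [hφ]
    · rw [snocMap_castSucc, ← ha z]
  · rintro _ ⟨y, rfl⟩
    obtain ⟨z, hz, hz'⟩ := hψ (fun i => y i.castSucc - a 0 i) (y (Fin.last d))
    refine ⟨_, intCast_mem_intLattice z, ?_⟩
    ext i
    refine Fin.lastCases ?_ (fun i => ?_) i
    · simp [hφ, hz']
    · rw [snocMap_castSucc, ← ha z]
      have := congr_fun hz i
      simp only [A, LinearMap.coe_mk, AddHom.coe_mk, sub_left_inj] at this
      simp [this]

/-- An affine endomorphism of `ℝ^m` that maps the lattice onto itself is an automorphism. -/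
theorem exists_affineEquiv_of_image_intLattice {m : ℕ} (g : (Fin m → ℝ) →ᵃ[ℝ] (Fin m → ℝ))
    (hg : g '' intLattice m = intLattice m) :
    ∃ f : (Fin m → ℝ) ≃ᵃ[ℝ] (Fin m → ℝ), ∀ x, f x = g x := by
  -- The range of the linear part contains the lattice, which spans, so it is everything;
  -- surjectivity gives injectivity in finite dimension.
  have hsub : ∀ z : Fin m → ℤ, (fun i => (z i : ℝ)) ∈ LinearMap.range g.linear := by
    intro z
    have h0 : g 0 ∈ intLattice m := by
      rw [← hg]; exact ⟨0, ⟨0, by ext; simp⟩, rfl⟩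
    obtain ⟨w, hw⟩ := h0
    have : (fun i => ((z + w) i : ℝ)) ∈ g '' intLattice m := by
      rw [hg]; exact intCast_mem_intLattice _
    obtain ⟨x, -, hx⟩ := this
    refine ⟨x, ?_⟩
    have h3 := g.map_vadd 0 x
    simp only [vadd_eq_add, add_zero] at h3
    rw [hx, ← hw] at h3
    ext i
    have := congr_fun h3 i
    simp only [Pi.add_apply, Int.cast_add] at this
    linarith
  have hsurj : Function.Surjective g.linear := by
    intro y
    change y ∈ LinearMap.range g.linear
    rw [pi_eq_sum_univ y]
    refine Submodule.sum_mem _ fun j _ => Submodule.smul_mem _ _ ?_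
    convert hsub (fun i => if j = i then 1 else 0) using 2
    simp
  have hinj := LinearMap.injective_iff_surjective.2 hsurj
  have hbij : Function.Bijective g :=
    ⟨(AffineMap.linear_injective_iff g).1 hinj, (AffineMap.linear_surjective_iff g).1 hsurj⟩
  exact ⟨AffineEquiv.ofBijective hbij, fun x => rfl⟩

theorem IsLatticePolytope.image {m : ℕ} {P : Set (Fin m → ℝ)} (hP : IsLatticePolytope P)
    (g : (Fin m → ℝ) →ᵃ[ℝ] (Fin m → ℝ)) (hg : g '' intLattice m = intLattice m) :
    IsLatticePolytope (g '' P) := by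
  obtain ⟨S, hfin, hS, rfl⟩ := hP
  refine ⟨g '' S, hfin.image g, ?_, g.image_convexHull S⟩
  rw [← hg]
  exact Set.image_mono hS

/-- A lift can be transported along a unimodular transformation. -/
theorem LatticeLift.exists_equivalent {d : ℕ} {Q : Set (Fin d → ℝ)} (L : LatticeLift Q)
    (g : (Fin (d + 1) → ℝ) →ᵃ[ℝ] (Fin (d + 1) → ℝ))
    (hg : g '' intLattice (d + 1) = intLattice (d + 1))
    (ρ : (Fin (d + 1) → ℝ) →ᵃ[ℝ] (Fin d → ℝ)) (hρ : IsLatticeProjection ρ)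
    (h : ∀ x, ρ (g x) = L.π x) :
    ∃ L' : LatticeLift Q, L.Equivalent L' ∧ L'.P = g '' L.P ∧ L'.π = ρ := by
  obtain ⟨f, hf⟩ := exists_affineEquiv_of_image_intLattice g hg
  have hfg : (f : (Fin (d + 1) → ℝ) → (Fin (d + 1) → ℝ)) = g := funext hf
  refine ⟨⟨g '' L.P, ρ, L.isLatticePolytope.image g hg, hρ, ?_⟩, ⟨f, ?_, ?_, ?_⟩, rfl, rfl⟩
  · rw [← Set.image_comp]
    exact (Set.image_congr fun x _ => h x).trans L.image_eq
  · rw [IsUnimodular, hfg, hg]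
  · rw [hfg]
  · intro x _
    rw [hf]
    exact h x

theorem latticeSize_image {m : ℕ} (P : Set (Fin m → ℝ))
    (g : (Fin m → ℝ) →ᵃ[ℝ] (Fin m → ℝ)) (hg : g '' intLattice m = intLattice m) :
    latticeSize (g '' P) = latticeSize P := by
  obtain ⟨f, hf⟩ := exists_affineEquiv_of_image_intLattice g hg
  have hfg : (f : (Fin m → ℝ) → (Fin m → ℝ)) = g := funext hf
  have hinj : Function.Injective g := hfg ▸ f.injective
  rw [latticeSize, latticeSize]
  conv_lhs => rw [← hg]
  rw [← Set.image_inter hinj, hinj.encard_image]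

/-! ### Vertical chords, boxes and shears. -/

/-- Two points of a convex set on a common vertical line over a lattice point are not far apart if
the set contains few lattice points. -/
theorem sub_le_of_latticeSize_le {d n : ℕ} {P : Set (Fin (d + 1) → ℝ)} (hP : Convex ℝ P)
    (hn : latticeSize P ≤ n) {x y : Fin (d + 1) → ℝ} (hx : x ∈ P) (hy : y ∈ P)
    (hxy : forgetLast d x = forgetLast d y) (hlat : forgetLast d x ∈ intLattice d) :
    y (Fin.last d) - x (Fin.last d) ≤ n + 1 := by
  set a := x (Fin.last d)
  set b := y (Fin.last d)
  obtain hab | hab := lt_or_ge b a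
  · have : (0 : ℝ) ≤ n := Nat.cast_nonneg n
    linarith
  obtain ⟨q, hq⟩ := hlat
  let pt : ℤ → Fin (d + 1) → ℝ :=
    fun k i => ((Fin.snoc (α := fun _ => ℤ) q k : Fin (d + 1) → ℤ) i : ℝ)
  have hpt : Function.Injective pt := fun k l h => by
    have := congr_fun h (Fin.last d)
    simpa [pt] using this
  have hseg : ∀ s : ℝ, a ≤ s → s ≤ b → ∀ u : Fin (d + 1) → ℝ, forgetLast d u = forgetLast d x →
      u (Fin.last d) = s → u ∈ P := by
    intro s has hsb u hu hus
    have hs : s ∈ segment ℝ a b := by rw [segment_eq_Icc hab]; exact ⟨has, hsb⟩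
    obtain ⟨α, β, hα, hβ, hαβ, hs⟩ := hs
    have : u = α • x + β • y := by
      ext i
      refine Fin.lastCases ?_ (fun i => ?_) i
      · rw [hus, ← hs]; rfl
      · have h1 := congr_fun hu i
        have h2 := congr_fun hxy i
        simp only [forgetLast_apply] at h1 h2
        simp only [Pi.add_apply, Pi.smul_apply, smul_eq_mul, h1, ← h2]
        rw [← add_mul, hαβ, one_mul]
    rw [this]
    exact hP hx hy hα hβ hαβ
  -- The interval from `a` to `b` contains more than `b - a - 1` integers, and each gives a lattice
  -- point of `P`.
  have hsub : pt '' (Finset.Icc ⌈a⌉ ⌊b⌋ : Finset ℤ) ⊆ P ∩ intLattice (d + 1) := by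
    rintro _ ⟨k, hk, rfl⟩
    rw [Finset.mem_coe, Finset.mem_Icc] at hk
    refine ⟨hseg k (Int.ceil_le.1 hk.1) (Int.le_floor.1 hk.2) _ ?_ ?_, intCast_mem_intLattice _⟩
    · rw [← hq]; ext i; simp [pt]
    · simp [pt]
  have hcard := (Set.encard_le_encard hsub).trans hn
  rw [hpt.encard_image, Set.encard_coe_eq_coe_finsetCard, Int.card_Icc] at hcard
  have hcard : (⌊b⌋ + 1 - ⌈a⌉).toNat ≤ n := by exact_mod_cast hcard
  have hcard : ⌊b⌋ + 1 - ⌈a⌉ ≤ (n : ℤ) := Int.toNat_le.1 hcard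
  have hcard : (⌊b⌋ : ℝ) + 1 - ⌈a⌉ ≤ n := by exact_mod_cast hcard
  have := Int.lt_floor_add_one b
  have := Int.ceil_lt_add_one a
  linarith

theorem finite_intLattice_inter_box (m : ℕ) (R : ℝ) :
    {x ∈ intLattice m | ∀ i, |x i| ≤ R}.Finite := by
  refine ((Set.Finite.pi (ι := Fin m) (fun _ => Set.finite_Icc (-⌈R⌉) ⌈R⌉)).image
    (fun (z : Fin m → ℤ) (i : Fin m) => (z i : ℝ))).subset ?_
  rintro _ ⟨⟨z, rfl⟩, h⟩
  refine ⟨z, fun i _ => ?_, rfl⟩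
  have h : |(z i : ℝ)| ≤ ⌈R⌉ := (h i).trans (Int.le_ceil R)
  exact abs_le.1 (by exact_mod_cast h)

/-- The shear `(x, t) ↦ (x, t - a · x - c)`. -/
noncomputable def shear {d : ℕ} (a : Fin d → ℤ) (c : ℤ) :
    (Fin (d + 1) → ℝ) →ᵃ[ℝ] (Fin (d + 1) → ℝ) :=
  snocMap (forgetLast d)
    ((LinearMap.proj (Fin.last d) : (Fin (d + 1) → ℝ) →ₗ[ℝ] ℝ).toAffineMap
      - (∑ j, (a j : ℝ) • (LinearMap.proj j.castSucc : (Fin (d + 1) → ℝ) →ₗ[ℝ] ℝ)).toAffineMap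
      - AffineMap.const ℝ _ (c : ℝ))

@[simp] theorem shear_castSucc {d : ℕ} (a : Fin d → ℤ) (c : ℤ) (x : Fin (d + 1) → ℝ) (i : Fin d) :
    shear a c x i.castSucc = x i.castSucc := by
  simp [shear]

@[simp] theorem shear_last {d : ℕ} (a : Fin d → ℤ) (c : ℤ) (x : Fin (d + 1) → ℝ) :
    shear a c x (Fin.last d) = x (Fin.last d) - ∑ j, a j * x j.castSucc - c := by
  simp [shear]

theorem shear_image_intLattice {d : ℕ} (a : Fin d → ℤ) (c : ℤ) :
    shear a c '' intLattice (d + 1) = intLattice (d + 1) := by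
  apply Set.Subset.antisymm
  · rintro _ ⟨_, ⟨z, rfl⟩, rfl⟩
    rw [mem_intLattice_iff]
    intro i
    refine Fin.lastCases ⟨z (Fin.last d) - ∑ j, a j * z j.castSucc - c, ?_⟩
      (fun i => ⟨z i.castSucc, ?_⟩) i <;> simp
  · rintro _ ⟨z, rfl⟩
    refine ⟨_, intCast_mem_intLattice (Fin.snoc (α := fun _ => ℤ) (fun i => z i.castSucc)
      (z (Fin.last d) + ∑ j, a j * z j.castSucc + c)), ?_⟩
    ext i
    refine Fin.lastCases ?_ (fun i => ?_) i <;> simp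
    ring

/-! ### Vertices and convex combinations. -/

/-- Every vertex of `π(P)` lies below a lattice point of the lattice polytope `P`. -/
theorem IsLatticePolytope.exists_lattice_point {m d : ℕ} {P : Set (Fin m → ℝ)}
    (hP : IsLatticePolytope P) (π : (Fin m → ℝ) →ᵃ[ℝ] (Fin d → ℝ)) {v : Fin d → ℝ}
    (hv : v ∈ (π '' P).extremePoints ℝ) : ∃ x ∈ P ∩ intLattice m, π x = v := by
  obtain ⟨S, -, hS, rfl⟩ := hP
  rw [π.image_convexHull] at hv
  obtain ⟨x, hx, rfl⟩ := extremePoints_convexHull_subset hv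
  exact ⟨x, ⟨subset_convexHull ℝ S hx, hS hx⟩, rfl⟩

/-- A point of a finite set at which a linear form is strictly maximal is a vertex of the convex
hull. -/
theorem mem_extremePoints_convexHull_of_lt {d : ℕ} {V : Set (Fin d → ℝ)} {v : Fin d → ℝ}
    (hv : v ∈ V) (l : (Fin d → ℝ) →ₗ[ℝ] ℝ) (hl : ∀ w ∈ V, w ≠ v → l w < l v) :
    v ∈ (convexHull ℝ V).extremePoints ℝ := by
  -- An open half-space with one boundary point adjoined is still convex.
  have key : convexHull ℝ V ⊆ {x | x = v ∨ l x < l v} := by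
    refine convexHull_min (fun w hw => or_iff_not_imp_left.2 (hl w hw)) ?_
    rw [convex_iff_forall_pos]
    rintro x (rfl | hx) y (rfl | hy) α β hα hβ hαβ
    · exact Or.inl (Convex.combo_self hαβ _)
    all_goals
      right
      simp only [map_add, map_smul, smul_eq_mul]
      obtain rfl := eq_sub_of_add_eq hαβ
      nlinarith
  refine mem_extremePoints_iff_left.2 ⟨subset_convexHull ℝ V hv, ?_⟩
  rintro x hx y hy ⟨α, β, hα, hβ, hαβ, hxy⟩
  refine (key hx).resolve_right fun hlx => ?_
  have hly : l y ≤ l v := by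
    obtain rfl | h := key hy
    · exact le_rfl
    · exact h.le
  have h : l v < l v := by
    conv_lhs => rw [← hxy]
    simp only [map_add, map_smul, smul_eq_mul]
    obtain rfl := eq_sub_of_add_eq hαβ
    nlinarith
  exact lt_irrefl _ h

theorem exists_weights_of_mem_convexHull_range {d : ℕ} {ι : Type*} [Fintype ι]
    (v : ι → Fin d → ℝ) {x : Fin d → ℝ} (hx : x ∈ convexHull ℝ (Set.range v)) :
    ∃ w : ι → ℝ, (∀ i, 0 ≤ w i) ∧ ∑ i, w i = 1 ∧ ∑ i, w i • v i = x := by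
  classical
  refine convexHull_min (t := {x | ∃ w : ι → ℝ, (∀ i, 0 ≤ w i) ∧ ∑ i, w i = 1 ∧
    ∑ i, w i • v i = x}) ?_ ?_ hx
  · rintro _ ⟨i, rfl⟩
    refine ⟨Pi.single i 1, fun j => ?_, by simp, by simp [Pi.single_apply]⟩
    rw [Pi.single_apply]
    split_ifs <;> simp
  · rintro _ ⟨w, hw, hw1, rfl⟩ _ ⟨w', hw', hw1', rfl⟩ α β hα hβ hαβ
    refine ⟨fun i => α * w i + β * w' i, fun i => ?_, ?_, ?_⟩
    · have := hw i
      have := hw' i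
      positivity
    · rw [Finset.sum_add_distrib, ← Finset.mul_sum, ← Finset.mul_sum, hw1, hw1', mul_one, mul_one,
        hαβ]
    · simp only [add_smul, mul_smul, Finset.sum_add_distrib, Finset.smul_sum]

/-! ### Finiteness criterion in terms of vertex heights. -/

/-- A lattice polytope with vertices `v i` has finitely many lifts of bounded size if every height
function on the vertices which nearly respects the affine dependencies that represent lattice
points is, up to an integral affine function, bounded. -/
theorem hasFinitelyManyLifts_of_heights {d : ℕ} {ι : Type*} [Fintype ι] (v : ι → Fin d → ℝ)
    (hv : ∀ i, v i ∈ (convexHull ℝ (Set.range v)).extremePoints ℝ)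
    (H : ∀ n : ℕ, ∃ M : ℝ, ∀ t : ι → ℤ,
      (∀ w w' : ι → ℝ, (∀ i, 0 ≤ w i) → (∀ i, 0 ≤ w' i) → ∑ i, w i = 1 → ∑ i, w' i = 1 →
        ∑ i, w i • v i = ∑ i, w' i • v i → ∑ i, w i • v i ∈ intLattice d →
        ∑ i, w i * t i - ∑ i, w' i * t i ≤ n + 1) →
      ∃ (a : Fin d → ℤ) (c : ℤ), ∀ i, |t i - ∑ j, a j * v i j - c| ≤ M) :
    HasFinitelyManyLiftsOfBoundedSize (convexHull ℝ (Set.range v)) := by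
  set Q := convexHull ℝ (Set.range v) with hQ
  intro n
  obtain ⟨M, hM⟩ := H n
  obtain ⟨R, hR⟩ : ∃ R : ℝ, ∀ x ∈ Q, ∀ i, |x i| ≤ R := by
    have hb : Bornology.IsBounded Q := isBounded_convexHull.2 (Set.finite_range v).isBounded
    obtain ⟨R, hR⟩ := hb.exists_norm_le
    exact ⟨R, fun x hx i => (norm_le_pi_norm x i).trans (hR x hx)⟩
  -- `R` bounds the coordinates inherited from `Q`; `M` bounds the heights of the sheared vertices,
  -- and `n + 1` the vertical distance of a lattice point from their convex hull.
  let B : Set (Fin (d + 1) → ℝ) :=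
    {x ∈ intLattice (d + 1) | ∀ i, |x i| ≤ max R (M + (n + 1))}
  let T : Set (LatticeLift Q) := {L | L.π = forgetLast d ∧ ∃ S ⊆ B, L.P = convexHull ℝ S}
  have hT : T.Finite := by
    refine Set.Finite.of_finite_image (f := LatticeLift.P) ?_ ?_
    · refine ((finite_intLattice_inter_box (d + 1) (max R (M + (n + 1)))).finite_subsets.image
        (convexHull ℝ)).subset ?_
      rintro _ ⟨L, ⟨-, S, hS, hL⟩, rfl⟩
      exact ⟨S, hS, hL.symm⟩
    · rintro ⟨P, π, _, _, _⟩ ⟨rfl, -⟩ ⟨P', π', _, _, _⟩ ⟨rfl, -⟩ rfl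
      rfl
  refine (hT.image (Quotient.mk (latticeLiftSetoid Q))).subset ?_
  rintro _ ⟨L, hsize, rfl⟩
  obtain ⟨φ, hφ⟩ := L.isLatticeProjection.exists_snocMap
  obtain ⟨L₁, hL₁, hP₁, hπ₁⟩ := L.exists_equivalent _ hφ _ (isLatticeProjection_forgetLast d)
    (forgetLast_comp_snocMap _ _)
  have hsize₁ : latticeSize L₁.P = n := by rw [hP₁, latticeSize_image _ _ hφ, hsize]
  have hpt : ∀ i, ∃ t : ℤ, ∃ x ∈ L₁.P, forgetLast d x = v i ∧ x (Fin.last d) = t := by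
    intro i
    obtain ⟨x, ⟨hx, z, rfl⟩, hxv⟩ := L₁.isLatticePolytope.exists_lattice_point L₁.π
      (v := v i) (by rw [L₁.image_eq]; exact hv i)
    exact ⟨z (Fin.last d), _, hx, hπ₁ ▸ hxv, rfl⟩
  choose t x hx hxv hxt using hpt
  have hconv {P : Set (Fin (d + 1) → ℝ)} (hP : IsLatticePolytope P) : Convex ℝ P := by
    obtain ⟨S, -, -, rfl⟩ := hP
    exact convex_convexHull ℝ S
  have hcomb : ∀ w : ι → ℝ, forgetLast d (∑ i, w i • x i) = ∑ i, w i • v i := by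
    intro w
    ext j
    simp [← hxv]
  obtain ⟨a, c, hac⟩ := hM t (by
    intro w w' hw hw' hw1 hw1' hww hlat
    have h := sub_le_of_latticeSize_le (hconv L₁.isLatticePolytope) hsize₁.le
      (x := ∑ i, w' i • x i) (y := ∑ i, w i • x i)
      ((hconv L₁.isLatticePolytope).sum_mem (fun i _ => hw' i) hw1' fun i _ => hx i)
      ((hconv L₁.isLatticePolytope).sum_mem (fun i _ => hw i) hw1 fun i _ => hx i)
      (by rw [hcomb, hcomb, hww]) (by rw [hcomb, ← hww]; exact hlat)
    simpa [hxt] using h)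
  have hπsh : ∀ y, forgetLast d (shear a c y) = L₁.π y := by
    intro y; rw [hπ₁]; ext; simp
  obtain ⟨L₂, hL₂, hP₂, hπ₂⟩ := L₁.exists_equivalent _ (shear_image_intLattice a c) _
    (isLatticeProjection_forgetLast d) hπsh
  have hsize₂ : latticeSize L₂.P = n := by
    rw [hP₂, latticeSize_image _ _ (shear_image_intLattice a c), hsize₁]
  refine ⟨L₂, ⟨hπ₂, L₂.P ∩ intLattice (d + 1), ?_, ?_⟩,
    (Quotient.sound ((LatticeLift.equivalent_equivalence Q).trans hL₁ hL₂)).symm⟩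
  · rintro y ⟨hy, hyl⟩
    refine ⟨hyl, ?_⟩
    have hyQ : forgetLast d y ∈ Q := by
      rw [← L₂.image_eq, hπ₂]; exact ⟨y, hy, rfl⟩
    have hylat : forgetLast d y ∈ intLattice d := by
      rw [← isLatticeProjection_forgetLast d]; exact ⟨y, hyl, rfl⟩
    -- The combination of lifted vertices with these weights lies on the same vertical line as `y`
    -- and has height at most `M` in absolute value.
    obtain ⟨w, hw, hw1, hwv⟩ := exists_weights_of_mem_convexHull_range v hyQ
    let x' : ι → Fin (d + 1) → ℝ := fun i => shear a c (x i)
    have hx' : ∀ i, x' i ∈ L₂.P := fun i => by rw [hP₂]; exact ⟨_, hx i, rfl⟩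
    have hlast : ∀ i, |x' i (Fin.last d)| ≤ M := by
      intro i
      have h := hac i
      simpa [x', hxt, ← hxv] using h
    have hproj : forgetLast d (∑ i, w i • x' i) = forgetLast d y := by
      rw [← hwv, ← hcomb w]
      ext j
      simp [x']
    have hmem : ∑ i, w i • x' i ∈ L₂.P :=
      (hconv L₂.isLatticePolytope).sum_mem (fun i _ => hw i) hw1 fun i _ => hx' i
    have hbound : |(∑ i, w i • x' i) (Fin.last d)| ≤ M := by
      rw [Finset.sum_apply]
      calc |∑ i, (w i • x' i) (Fin.last d)| ≤ ∑ i, |(w i • x' i) (Fin.last d)| :=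
            Finset.abs_sum_le_sum_abs _ _
        _ ≤ ∑ i, w i * M := Finset.sum_le_sum fun i _ => by
            rw [Pi.smul_apply, smul_eq_mul, abs_mul, abs_of_nonneg (hw i)]
            exact mul_le_mul_of_nonneg_left (hlast i) (hw i)
        _ = M := by rw [← Finset.sum_mul, hw1, one_mul]
    have h1 := sub_le_of_latticeSize_le (hconv L₂.isLatticePolytope) hsize₂.le hmem hy hproj
      (hproj ▸ hylat)
    have h2 := sub_le_of_latticeSize_le (hconv L₂.isLatticePolytope) hsize₂.le hy hmem hproj.symm
      hylat
    refine Fin.lastCases (le_max_of_le_right ?_)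
      (fun i => le_max_of_le_left (hR _ hyQ i))
    rw [abs_le] at hbound ⊢
    constructor <;> linarith [hbound.1, hbound.2]
  -- A lattice polytope is the hull of its own lattice points.
  · obtain ⟨S, -, hS, hP⟩ := L₂.isLatticePolytope
    apply Set.Subset.antisymm
    · conv_lhs => rw [hP]
      exact convexHull_mono fun y hy => ⟨hP ▸ subset_convexHull ℝ S hy, hS hy⟩
    · exact convexHull_min Set.inter_subset_left (hconv L₂.isLatticePolytope)

/-! ### The pyramid and the prism. -/

/-- Integral division with remainder, over the reals. -/
theorem exists_int_abs_sub_three_mul_le (k : ℤ) :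
    ∃ q : ℤ, 0 ≤ (k : ℝ) - 3 * q ∧ (k : ℝ) - 3 * q ≤ 3 := by
  refine ⟨k / 3, ?_, ?_⟩
  · have : 0 ≤ k - 3 * (k / 3) := by omega
    exact_mod_cast this
  · have : k - 3 * (k / 3) ≤ 3 := by omega
    exact_mod_cast this

/-- The vertices of `polytopeM9`. -/
def verticesM9 : Fin 5 → Fin 3 → ℝ :=
  ![![-1, 0, 0], ![2, 0, 0], ![0, -1, 0], ![0, 2, 0], ![1, 1, 3]]

/-- The vertices of `polytopeM10`. -/
def verticesM10 : Fin 6 → Fin 3 → ℝ :=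
  ![![1, 0, 0], ![0, 1, 0], ![-1, -1, 0], ![2, 2, 3], ![1, 3, 3], ![0, 1, 3]]

theorem polytopeM9_eq : polytopeM9 = convexHull ℝ (Set.range verticesM9) := by
  simp only [polytopeM9, verticesM9, Matrix.range_cons, Matrix.range_empty,
    Set.union_empty, Set.singleton_union]

theorem polytopeM10_eq : polytopeM10 = convexHull ℝ (Set.range verticesM10) := by
  simp only [polytopeM10, verticesM10, Matrix.range_cons, Matrix.range_empty,
    Set.union_empty, Set.singleton_union]

/-- The linear form on `ℝ³` with the given coefficients. -/
def linearForm (a : Fin 3 → ℝ) : (Fin 3 → ℝ) →ₗ[ℝ] ℝ :=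
  ∑ j, a j • LinearMap.proj j

theorem linearForm_apply (a x : Fin 3 → ℝ) :
    linearForm a x = a 0 * x 0 + a 1 * x 1 + a 2 * x 2 := by
  simp [linearForm, Fin.sum_univ_three]

theorem mem_extremePoints_of_linearForm {ι : Type*} (v : ι → Fin 3 → ℝ) (i : ι) (a : Fin 3 → ℝ)
    (h : ∀ j, j ≠ i → linearForm a (v j) < linearForm a (v i)) :
    v i ∈ (convexHull ℝ (Set.range v)).extremePoints ℝ := by
  refine mem_extremePoints_convexHull_of_lt ⟨i, rfl⟩ (linearForm a) ?_
  rintro _ ⟨j, rfl⟩ hj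
  exact h j fun hji => hj (by rw [hji])

theorem verticesM9_mem_extremePoints (i : Fin 5) :
    verticesM9 i ∈ (convexHull ℝ (Set.range verticesM9)).extremePoints ℝ := by
  refine mem_extremePoints_of_linearForm _ i
    ((![![-1, 0, 0], ![1, 0, 0], ![0, -1, 0], ![0, 1, 0], ![0, 0, 1]] :
      Fin 5 → Fin 3 → ℝ) i) fun j hj => ?_
  fin_cases i <;> fin_cases j <;> first
    | exact absurd rfl hj
    | (simp [linearForm_apply, verticesM9]; done)
    | (simp [linearForm_apply, verticesM9]; norm_num)

theorem verticesM10_mem_extremePoints (i : Fin 6) :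
    verticesM10 i ∈ (convexHull ℝ (Set.range verticesM10)).extremePoints ℝ := by
  -- The third coefficient favours the bottom or the top triangle, the first two a corner of it.
  refine mem_extremePoints_of_linearForm _ i
    ((![![1, 0, -1], ![0, 1, -1], ![-1, -1, -1], ![1, 0, 1], ![0, 1, 1], ![-1, -1, 3]] :
      Fin 6 → Fin 3 → ℝ) i) fun j hj => ?_
  fin_cases i <;> fin_cases j <;> first
    | exact absurd rfl hj
    | (simp [linearForm_apply, verticesM10]; done)
    | (simp [linearForm_apply, verticesM10]; norm_num)

/-- The diagonals of the base cross at the lattice point `0`, which divides each in ratio 1 : 2;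
this is the only affine dependency. -/
theorem hasFinitelyManyLifts_polytopeM9 : HasFinitelyManyLiftsOfBoundedSize polytopeM9 := by
  rw [polytopeM9_eq]
  refine hasFinitelyManyLifts_of_heights _ verticesM9_mem_extremePoints fun n =>
    ⟨3 * (n + 1) + 6, fun t ht => ?_⟩
  have hzero : (0 : Fin 3 → ℝ) ∈ intLattice 3 := ⟨0, by ext; simp⟩
  let w : Fin 5 → ℝ := ![2 / 3, 1 / 3, 0, 0, 0]
  let w' : Fin 5 → ℝ := ![0, 0, 2 / 3, 1 / 3, 0]
  have hw : ∀ i, 0 ≤ w i := by intro i; fin_cases i <;> norm_num [w]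
  have hw' : ∀ i, 0 ≤ w' i := by intro i; fin_cases i <;> norm_num [w']
  have hw1 : ∑ i, w i = 1 := by norm_num [w, Fin.sum_univ_succ]
  have hw1' : ∑ i, w' i = 1 := by norm_num [w', Fin.sum_univ_succ]
  have hwv : ∑ i, w i • verticesM9 i = 0 := by
    rw [Fin.sum_univ_five]
    ext j; fin_cases j <;> simp [w, verticesM9] <;> norm_num
  have hwv' : ∑ i, w' i • verticesM9 i = 0 := by
    rw [Fin.sum_univ_five]
    ext j; fin_cases j <;> simp [w', verticesM9] <;> norm_num
  have h1 := ht w w' hw hw' hw1 hw1' (hwv.trans hwv'.symm) (hwv ▸ hzero)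
  have h2 := ht w' w hw' hw hw1' hw1 (hwv'.trans hwv.symm) (hwv' ▸ hzero)
  simp [w, w', Fin.sum_univ_five] at h1 h2
  -- The affine function below is exact at vertices 0 and 2. Rounding `α` and `γ` costs at most 3 at
  -- vertices 1 and 4, and the dependency controls vertex 3 up to `3 * (n + 1) + 3`.
  obtain ⟨α, hα, hα'⟩ := exists_int_abs_sub_three_mul_le (t 1 - t 0)
  obtain ⟨γ, hγ, hγ'⟩ := exists_int_abs_sub_three_mul_le
    (t 4 - (t 0 + α) - α - (t 0 + α - t 2))
  push_cast at hα hα' hγ hγ'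
  have hn : (0 : ℝ) ≤ n := Nat.cast_nonneg n
  refine ⟨![α, t 0 + α - t 2, γ], t 0 + α, fun i => ?_⟩
  rw [abs_le]
  fin_cases i <;> simp [verticesM9, Fin.sum_univ_three] <;> constructor <;> linarith

/-- The dependencies come from two parallelogram faces, `v 0 + v 4 = v 1 + v 3` and `v 1 + v 5 = v 2
+ v 4`. Divided by 3 and padded with a common term, each becomes two representations of one lattice
point at level 1. -/
theorem hasFinitelyManyLifts_polytopeM10 : HasFinitelyManyLiftsOfBoundedSize polytopeM10 := by
  rw [polytopeM10_eq]
  refine hasFinitelyManyLifts_of_heights _ verticesM10_mem_extremePoints fun n =>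
    ⟨6 * (n + 1) + 12, fun t ht => ?_⟩
  have hp : (![1, 1, 1] : Fin 3 → ℝ) ∈ intLattice 3 :=
    ⟨![1, 1, 1], by ext j; fin_cases j <;> simp⟩
  have hq : (![0, 1, 1] : Fin 3 → ℝ) ∈ intLattice 3 :=
    ⟨![0, 1, 1], by ext j; fin_cases j <;> simp⟩
  let w : Fin 6 → ℝ := ![2 / 3, 0, 0, 0, 1 / 3, 0]
  let w' : Fin 6 → ℝ := ![1 / 3, 1 / 3, 0, 1 / 3, 0, 0]
  let u : Fin 6 → ℝ := ![0, 2 / 3, 0, 0, 0, 1 / 3]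
  let u' : Fin 6 → ℝ := ![0, 1 / 3, 1 / 3, 0, 1 / 3, 0]
  have hw : ∀ i, 0 ≤ w i := by intro i; fin_cases i <;> norm_num [w]
  have hw' : ∀ i, 0 ≤ w' i := by intro i; fin_cases i <;> norm_num [w']
  have hu : ∀ i, 0 ≤ u i := by intro i; fin_cases i <;> norm_num [u]
  have hu' : ∀ i, 0 ≤ u' i := by intro i; fin_cases i <;> norm_num [u']
  have hw1 : ∑ i, w i = 1 := by norm_num [w, Fin.sum_univ_succ]
  have hw1' : ∑ i, w' i = 1 := by norm_num [w', Fin.sum_univ_succ]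
  have hu1 : ∑ i, u i = 1 := by norm_num [u, Fin.sum_univ_succ]
  have hu1' : ∑ i, u' i = 1 := by norm_num [u', Fin.sum_univ_succ]
  have hwv : ∑ i, w i • verticesM10 i = ![1, 1, 1] := by
    rw [Fin.sum_univ_six]
    ext j; fin_cases j <;> simp [w, verticesM10] <;> norm_num
  have hwv' : ∑ i, w' i • verticesM10 i = ![1, 1, 1] := by
    rw [Fin.sum_univ_six]
    ext j; fin_cases j <;> simp [w', verticesM10] <;> norm_num
  have huv : ∑ i, u i • verticesM10 i = ![0, 1, 1] := by
    rw [Fin.sum_univ_six]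
    ext j; fin_cases j <;> simp [u, verticesM10] <;> norm_num
  have huv' : ∑ i, u' i • verticesM10 i = ![0, 1, 1] := by
    rw [Fin.sum_univ_six]
    ext j; fin_cases j <;> simp [u', verticesM10]
  have h1 := ht w w' hw hw' hw1 hw1' (hwv.trans hwv'.symm) (hwv ▸ hp)
  have h2 := ht w' w hw' hw hw1' hw1 (hwv'.trans hwv.symm) (hwv' ▸ hp)
  have h3 := ht u u' hu hu' hu1 hu1' (huv.trans huv'.symm) (huv ▸ hq)
  have h4 := ht u' u hu' hu hu1' hu1 (huv'.trans huv.symm) (huv' ▸ hq)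
  simp [w, w', u, u', Fin.sum_univ_six] at h1 h2 h3 h4
  -- The bottom triangle has centroid `0`, so `c` is its rounded mean height. The affine function is
  -- exact at vertices 0 and 1 and off by at most 3 at 2 and 3; the dependencies carry the bound to
  -- 4 and then to 5, each adding `3 * (n + 1)`.
  obtain ⟨c, hc, hc'⟩ := exists_int_abs_sub_three_mul_le (t 0 + t 1 + t 2)
  obtain ⟨γ, hγ, hγ'⟩ := exists_int_abs_sub_three_mul_le
    (t 3 - c - 2 * (t 0 - c) - 2 * (t 1 - c))
  push_cast at hc hc' hγ hγ'
  have hn : (0 : ℝ) ≤ n := Nat.cast_nonneg n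
  refine ⟨![t 0 - c, t 1 - c, γ], c, fun i => ?_⟩
  rw [abs_le]
  fin_cases i <;> simp [verticesM10, Fin.sum_univ_three] <;> constructor <;> linarith

theorem mainTheorem10 :
    HasFinitelyManyLiftsOfBoundedSize polytopeM9 ∧
      HasFinitelyManyLiftsOfBoundedSize polytopeM10 :=
  ⟨hasFinitelyManyLifts_polytopeM9, hasFinitelyManyLifts_polytopeM10⟩
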